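/- Setting. Let $(\mathcal S,\mathcal A,p,r)$ be a finite MDP with non-empty action set $\mathcal A$, transition probabilities $p(s,a,\cdot)$ and rewards $r(s,a,s')\in\mathbb R$. The state set $\mathcal S$ contains a sink $e$ with $p(e,a,e)=1$ and $r(e,a,e)=0$ for every $a\in\mathcal A$. The MDP is transient: for every stationary deterministic policy $\pi\colon\mathcal S\to\mathcal A$ and all $s,s'\in\mathcal S\setminus\{e\}$, $\sum_{t=0}^\infty \mathbb P^{\pi,s}[\tilde s_t=s']<\infty$. Let $\mathcal B$ be a finite set of positive reals, and fix $\beta\in\mathcal B$ and $z_{\min},z_{\max}\in\mathbb R$. Define the loss $\ell_\beta(z)=\beta^{-1}(e^{-\beta z}-1)+z$ and, for $q\colon\mathcal S\times\mathcal A\to\mathbb R$, the operator $$(\hat B_\beta q)(s,a)=\operatorname*{arg\,min}_{y\in\mathbb R}\ \sum_{s'\in\mathcal S}p(s,a,s')\,\ell_\beta\Bigl(r(s,a,s')+\max_{a'\in\mathcal A}q(s',a')-y\Bigr),$$ whose minimizer is unique. Algorithm (ERM-TRC Q-learning at risk level $\beta$). The input consists of random samples $(\tilde s_i,\tilde a_i,\tilde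 s'_i)_{i\ge 0}$ in $\mathcal S\times\mathcal A\times\mathcal S$ and random step sizes $(\tilde\eta_i)_{i\ge0}$, real-valued and almost surely nonnegative, all defined on one probability space. Start with $\tilde q_0(s,a)=0$ for all $(s,a)$. At step $i$, compute the TD residual $$\tilde z_i=r(\tilde s_i,\tilde a_i,\tilde s'_i)+\max_{a'\in\mathcal A}\tilde q_i(\tilde s'_i,a')-\tilde q_i(\tilde s_i,\tilde a_i).$$ If $\tilde z_i\notin[z_{\min},z_{\max}]$, set $\tilde q_{i+1}(\tilde s_i,\tilde a_i)=-\infty$ and return. Otherwise set $\tilde q_{i+1}(\tilde s_i,\tilde a_i)=\tilde q_i(\tilde s_i,\tilde a_i)-\tilde\eta_i\,(e^{-\beta\tilde z_i}-1)$. All other entries are unchanged in either case. After a return, the table stays as it is. Theorem. Assume the following. 1. For all $i\in\mathbb N$ and $s'\in\mathcal S$, almost surely $$\mathbb P\bigl[\tilde s'_i=s'\mid \mathcal G_{i-1},\tilde s_i,\tilde a_i,\tilde\eta_i\bigr]=p(\tilde s_i,\tilde a_i,s'),$$ where $\mathcal G_{i-1}$ is generated by $(\tilde\eta_l,\tilde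 s_l,\tilde a_l,\tilde s'_l)_{l<i}$. 2. Almost surely, for every $s\in\mathcal S\setminus\{e\}$ and $a\in\mathcal A$, $$\sum_{i:\,(\tilde s_i,\tilde a_i)=(s,a)}\tilde\eta_i=\infty,\qquad \sum_{i:\,(\tilde s_i,\tilde a_i)=(s,a)}\tilde\eta_i^2<\infty .$$ 3. Almost surely, $\tilde z_i\in[z_{\min},z_{\max}]$ at every step $i$ at which the algorithm is running (hence for every $i$). Then there is $q_\infty\colon\mathcal S\times\mathcal A\to\mathbb R$ with $q_\infty=\hat B_\beta q_\infty$ such that almost surely $\tilde q_i(s,a)\to q_\infty(s,a)$ as $i\to\infty$ for all $(s,a)\in\mathcal S\times\mathcal A$. -/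

import Mathlib

open MeasureTheory Filter Topology

noncomputable section

/-- `stateProb p π s t s'` is the probability that the Markov chain with transition function `p`,
started in `s` and controlled by the stationary deterministic policy `π`, is in `s'` at time `t`. -/
def stateProb {S A : Type*} [Fintype S] [DecidableEq S] (p : S → A → S → ℝ) (π : S → A) (s : S) :
    ℕ → S → ℝ
  | 0, s' => if s' = s then 1 else 0
  | t + 1, s' => ∑ x, stateProb p π s t x * p x (π x) s'

/-- A finite transient MDP with an absorbing, reward-free sink state `e`. -/
structure TransientMDP (S A : Type*) [Fintype S] [DecidableEq S] where
  /-- transition probabilities `p s a s'` -/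
  p : S → A → S → ℝ
  /-- rewards `r s a s'` -/
  r : S → A → S → ℝ
  /-- the sink state -/
  e : S
  p_mem : ∀ s a, p s a ∈ stdSimplex ℝ S
  p_sink : ∀ a, p e a e = 1
  r_sink : ∀ a, r e a e = 0
  transient : ∀ π : S → A, ∀ s s', s ≠ e → s' ≠ e → Summable fun t => stateProb p π s t s'

/-- The exponential loss `ℓ_β(z) = β⁻¹ (exp (-β z) - 1) + z`. -/
def ermLoss (β z : ℝ) : ℝ := β⁻¹ * (Real.exp (-β * z) - 1) + z

section Bellman

variable {S A : Type*} [Fintype S] [DecidableEq S] [Fintype A] [Nonempty A]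

/-- `max_{a'} q(s, a')`. -/
def maxQ (q : S → A → ℝ) (s : S) : ℝ :=
  Finset.univ.sup' Finset.univ_nonempty fun a' => q s a'

/-- `y ↦ 𝔼^{a,s} [ℓ_β (r(s, a, s̃₁) + max_{a'} q(s̃₁, a') - y)]`, where `s̃₁ ∼ p(s, a, ·)`. -/
def bellmanLoss (M : TransientMDP S A) (β : ℝ) (q : S → A → ℝ) (s : S) (a : A) (y : ℝ) : ℝ :=
  ∑ s', M.p s a s' * ermLoss β (M.r s a s' + maxQ q s' - y)

/-- The elicitability-based ERM Bellman operator
`(B̂_β q)(s, a) = argmin_y 𝔼^{a,s} [ℓ_β (r(s, a, s̃₁) + max_{a'} q(s̃₁, a') - y)]`.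
For `β > 0` the minimiser exists and is unique, see `existsUnique_isMinOn_bellmanLoss`. -/
def ermBellman (M : TransientMDP S A) (β : ℝ) (q : S → A → ℝ) : S → A → ℝ :=
  fun s a => Classical.epsilon fun y : ℝ => IsMinOn (bellmanLoss M β q s a) Set.univ y

theorem existsUnique_isMinOn_bellmanLoss (M : TransientMDP S A) {β : ℝ} (hβ : 0 < β)
    (q : S → A → ℝ) (s : S) (a : A) :
    ∃! y : ℝ, IsMinOn (bellmanLoss M β q s a) Set.univ y := by
  obtain ⟨hp0, hp1⟩ := M.p_mem s a
  set x : S → ℝ := fun s' => M.r s a s' + maxQ q s' with hx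
  set C : ℝ := ∑ s', M.p s a s' * Real.exp (-β * x s') with hC
  have hCpos : 0 < C := by
    obtain ⟨s₀, -, hs₀⟩ : ∃ s₀ ∈ Finset.univ, 0 < M.p s a s₀ := by
      by_contra! h
      have : ∑ s', M.p s a s' ≤ 0 := Finset.sum_nonpos h
      linarith
    exact Finset.sum_pos' (fun i _ => mul_nonneg (hp0 i) (Real.exp_pos _).le)
      ⟨s₀, Finset.mem_univ _, mul_pos hs₀ (Real.exp_pos _)⟩
  have hf : ∀ y, bellmanLoss M β q s a y =
      β⁻¹ * (C * Real.exp (β * y) - 1) + (∑ s', M.p s a s' * x s') - y := by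
    intro y
    have h1 : ∀ s', M.p s a s' * ermLoss β (M.r s a s' + maxQ q s' - y) =
        β⁻¹ * Real.exp (β * y) * (M.p s a s' * Real.exp (-β * x s')) + M.p s a s' * x s'
          - (β⁻¹ + y) * M.p s a s' := by
      intro s'
      have h2 : Real.exp (-β * (x s' - y)) = Real.exp (-β * x s') * Real.exp (β * y) := by
        rw [← Real.exp_add]; congr 1; ring
      have h3 : M.r s a s' + maxQ q s' - y = x s' - y := rfl
      rw [h3, ermLoss, h2]
      ring
    unfold bellmanLoss
    rw [Finset.sum_congr rfl fun s' _ => h1 s', Finset.sum_sub_distrib, Finset.sum_add_distrib,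
      ← Finset.mul_sum, ← Finset.mul_sum, hp1]
    ring
  set z : ℝ := -β⁻¹ * Real.log C with hz
  have hdiff : ∀ y, bellmanLoss M β q s a y - bellmanLoss M β q s a z =
      β⁻¹ * (Real.exp (β * (y - z)) - (β * (y - z) + 1)) := by
    intro y
    have h1 : ∀ y, C * Real.exp (β * y) = Real.exp (β * (y - z)) := by
      intro y
      have h2 : β * (y - z) = Real.log C + β * y := by
        rw [hz]; field_simp; ring
      rw [h2, Real.exp_add, Real.exp_log hCpos]
    rw [hf, hf, h1, h1, sub_self, mul_zero, Real.exp_zero]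
    field_simp
    ring
  have hβ' : 0 < β⁻¹ := inv_pos.mpr hβ
  refine ⟨z, fun y _ => ?_, fun w hw => ?_⟩
  · have h1 := mul_nonneg hβ'.le (sub_nonneg.mpr (Real.add_one_le_exp (β * (y - z))))
    have h2 := hdiff y
    change bellmanLoss M β q s a z ≤ bellmanLoss M β q s a y
    linarith
  · by_contra hne
    have h1 : β * (w - z) ≠ 0 := mul_ne_zero hβ.ne' (sub_ne_zero.mpr hne)
    have h2 := mul_pos hβ' (sub_pos.mpr (Real.add_one_lt_exp h1))
    have h3 := hdiff w
    have h4 : bellmanLoss M β q s a w ≤ bellmanLoss M β q s a z := hw (Set.mem_univ z)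
    linarith

end Bellman

/-- State of the Q-learning algorithm for one risk level: still running with a real table `q`, or
returned with a final table (which contains the value `-∞`). -/
inductive QState (S A : Type*) where
  | running (q : S → A → ℝ)
  | returned (q : S → A → EReal)

/-- The current table of estimates. -/
def QState.table {S A : Type*} : QState S A → S → A → EReal
  | .running q => fun s a => (q s a : EReal)
  | .returned q => q

section Algorithm

variable {S A : Type*} [Fintype S] [DecidableEq S] [Fintype A] [DecidableEq A] [Nonempty A]

/-- The TD residual `z = r(s, a, s') + max_{a'} q(s', a') - q(s, a)`. -/
def tdResidual (M : TransientMDP S A) (q : S → A → ℝ) (s : S) (a : A) (s' : S) : ℝ :=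
  M.r s a s' + maxQ q s' - q s a

open Classical in
/-- One iteration of ERM-TRC Q-learning at risk level `β` with sample `(s, a, s')`, step size `η`
and bounds `zmin`, `zmax`. Only the entry `(s, a)` changes. If the TD residual leaves
`[zmin, zmax]`, that entry is set to `-∞` and the algorithm returns. -/
def ermQStep (M : TransientMDP S A) (β zmin zmax η : ℝ) (s : S) (a : A) (s' : S) :
    QState S A → QState S A
  | .running q =>
      if tdResidual M q s a s' ∈ Set.Icc zmin zmax then
        .running fun x b =>
          if x = s ∧ b = a then q x b - η * (Real.exp (-β * tdResidual M q s a s') - 1) else q x b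
      else
        .returned fun x b => if x = s ∧ b = a then ⊥ else (q x b : EReal)
  | .returned q => .returned q

/-- The iterates `q̃_i(·, ·, β)` of ERM-TRC Q-learning, started from `q̃_0 = 0`, along one
realisation of the samples and step sizes. -/
def ermQLearning (M : TransientMDP S A) (β zmin zmax : ℝ) (η : ℕ → ℝ) (s : ℕ → S) (a : ℕ → A)
    (s' : ℕ → S) : ℕ → QState S A
  | 0 => .running fun _ _ => 0
  | i + 1 => ermQStep M β zmin zmax (η i) (s i) (a i) (s' i)
      (ermQLearning M β zmin zmax η s a s' i)

end Algorithm

/-- The σ-algebra generated by `(η̃_l, s̃_l, ã_l, s̃'_l)` for `l < i` together with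
`s̃_i, ã_i, η̃_i`. -/
abbrev sampleHistory {Ω S A : Type*} [MeasurableSpace S] [MeasurableSpace A] (η : ℕ → Ω → ℝ)
    (s : ℕ → Ω → S) (a : ℕ → Ω → A) (s' : ℕ → Ω → S) (i : ℕ) : MeasurableSpace Ω :=
  (⨆ l : ℕ, ⨆ _ : l < i,
    (MeasurableSpace.comap (η l) inferInstance ⊔ MeasurableSpace.comap (s l) inferInstance ⊔
      MeasurableSpace.comap (a l) inferInstance ⊔ MeasurableSpace.comap (s' l) inferInstance)) ⊔
  (MeasurableSpace.comap (s i) inferInstance ⊔ MeasurableSpace.comap (a i) inferInstance ⊔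
    MeasurableSpace.comap (η i) inferInstance)

/-- The samples follow the transition probabilities:
`ℙ[s̃'_i = x | 𝒢_{i-1}, s̃_i, ã_i, η̃_i] = p(s̃_i, ã_i, x)` almost surely, for all `i` and `x`. -/
def SamplesFollow {Ω S A : Type*} [MeasurableSpace Ω] [Fintype S] [DecidableEq S]
    [MeasurableSpace S] [MeasurableSpace A] (M : TransientMDP S A) (P : Measure Ω)
    (η : ℕ → Ω → ℝ) (s : ℕ → Ω → S) (a : ℕ → Ω → A) (s' : ℕ → Ω → S) : Prop :=
  ∀ (i : ℕ) (x : S),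
    P[(s' i ⁻¹' {x}).indicator (fun _ => (1 : ℝ)) | sampleHistory η s a s' i] =ᵐ[P]
      fun ω => M.p (s i ω) (a i ω) x

/-- Robbins-Monro conditions along the visits to `(x, b)`: the step sizes used at the times `i`
with `(s_i, a_i) = (x, b)` have infinite sum and finite sum of squares. -/
def RobbinsMonroAt {S A : Type*} [DecidableEq S] [DecidableEq A] (η : ℕ → ℝ) (s : ℕ → S)
    (a : ℕ → A) (x : S) (b : A) : Prop :=
  Tendsto (fun n => ∑ i ∈ Finset.range n, if s i = x ∧ a i = b then η i else 0) atTop atTop ∧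
    Summable fun i => if s i = x ∧ a i = b then η i ^ 2 else 0

end

/-! ### One-dimensional stochastic approximation -/

noncomputable section

/-! For a fixed table `q`, the mean of the update factor `exp (-β z) - 1` at `(x, b)` is `exp (β
q(x,b)) * expBackup q x b - 1`. It is positive exactly when `q(x,b)` exceeds its Bellman value, so
on average the recursion pulls each entry towards `ermBellman q`. No contraction is used;
monotonicity and transience replace it.

Suppose that the iterates are bounded and the noise sums converge. Let `U` and `L` be the entrywise
limsup and liminf. Eventually `q_i ≤ U + ε`, so above the backup of `U` the drift is uniformly
downward and `eventually_le_of_drift` gives `U ≤ ermBellman U` off the sink; symmetrically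
`ermBellman L ≤ L`. The comparison principle `le_of_expBackup_le` yields `U ≤ L`: a positive maximum
of `U - L` would propagate to all successors, so a `U`-greedy policy would never reach the sink,
against transience (`eq_empty_of_closed`). Hence the iterates converge, and the limit is a fixed
point.

Boundedness (`exists_abs_freeIterates_le`) comes from the residual bounds. Conditioning extends them
from the sampled successor to every successor of positive probability, so unboundedness at a state
would also propagate to successors and again produce a closed set off the sink. Bounded iterates
give the noise square-summable coefficients, and it converges as a martingale transform
(`ae_tendsto_sum_mul_of_summable_sq`). -/

/-- A stochastic approximation recursion is eventually below `Y` up to `ε` when its drift is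
uniformly negative above `Y`. -/
theorem eventually_le_of_drift {x η g n : ℕ → ℝ} {K Y l : ℝ}
    (hrec : ∀ i, x (i + 1) = x i - η i * g i + n i) (hη : ∀ i, 0 ≤ η i)
    (hη0 : Tendsto η atTop (𝓝 0))
    (hsum : Tendsto (fun k => ∑ i ∈ Finset.range k, η i) atTop atTop)
    (hn : Tendsto (fun k => ∑ i ∈ Finset.range k, n i) atTop (𝓝 l))
    (hg : ∀ i, -K ≤ g i)
    (hdrift : ∀ ε > 0, ∃ δ > 0, ∀ᶠ i in atTop, Y + ε < x i → δ ≤ g i) {ε : ℝ} (hε : 0 < ε) :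
    ∀ᶠ i in atTop, x i ≤ Y + ε := by
  -- Adding the tail of the noise series makes the recursion noise-free, and `u - x` tends to 0.
  set u : ℕ → ℝ := fun i => x i + (l - ∑ j ∈ Finset.range i, n j) with hu
  have hurec : ∀ i, u (i + 1) = u i - η i * g i := fun i => by
    simp only [hu, Finset.sum_range_succ, hrec]; ring
  -- Four margins: one for `|u - x|` where the drift starts, one for the drift threshold, one for a
  -- single upward jump `η i * K`, one for returning from `u` to `x`.
  set ε' := ε / 4 with hε'
  have hε'0 : 0 < ε' := by positivity
  obtain ⟨δ, hδ, hd⟩ := hdrift ε' hε'0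
  have hK : Tendsto (fun i => η i * K) atTop (𝓝 0) := by simpa using hη0.mul_const K
  have hall := (hd.and (hK.eventually_lt_const hε'0)).and
    ((hn.eventually_lt_const (lt_add_of_pos_right l hε'0)).and
      (hn.eventually_const_lt (sub_lt_self l hε'0)))
  obtain ⟨N, hN⟩ := eventually_atTop.1 hall
  have hdec : ∀ i, N ≤ i → Y + 2 * ε' < u i → u (i + 1) ≤ u i - δ * η i := by
    intro i hi hui
    obtain ⟨⟨h1, -⟩, h3, h4⟩ := hN i hi
    have h5 : Y + ε' < x i := by simp only [hu] at hui; linarith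
    rw [hurec]
    nlinarith [h1 h5, hη i]
  have hstay : ∀ i, N ≤ i → u i ≤ Y + 3 * ε' → u (i + 1) ≤ Y + 3 * ε' := by
    intro i hi hui
    by_cases h : Y + 2 * ε' < u i
    · have := hdec i hi h
      nlinarith [hη i]
    · obtain ⟨⟨-, h2⟩, -, -⟩ := hN i hi
      rw [hurec]
      nlinarith [hη i, hg i]
  -- Otherwise `u` would lose `δ * η i` at every step, and the steps have infinite sum.
  have hhit : ∃ k, N ≤ k ∧ u k ≤ Y + 3 * ε' := by
    by_contra! hno
    have hle : ∀ k, N ≤ k → u k + δ * ∑ i ∈ Finset.range k, η i ≤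
        u N + δ * ∑ i ∈ Finset.range N, η i := by
      intro k hk
      induction k, hk using Nat.le_induction with
      | base => exact le_rfl
      | succ k hk ih =>
        have := hdec k hk (by linarith [hno k hk])
        rw [Finset.sum_range_succ, mul_add]
        linarith
    obtain ⟨k, hk1, hk2⟩ := (((hsum.const_mul_atTop hδ).eventually_gt_atTop
      (u N + δ * ∑ i ∈ Finset.range N, η i - (Y + 3 * ε'))).and (eventually_ge_atTop N)).exists
    linarith [hle k hk2, hno k hk2]
  obtain ⟨k, hkN, hk⟩ := hhit
  have hfin : ∀ i, k ≤ i → u i ≤ Y + 3 * ε' := by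
    intro i hi
    induction i, hi using Nat.le_induction with
    | base => exact hk
    | succ i hi ih => exact hstay i (hkN.trans hi) ih
  filter_upwards [eventually_ge_atTop k] with i hi
  obtain ⟨-, h3, h4⟩ := hN i (hkN.trans hi)
  have := hfin i hi
  simp only [hu] at this
  linarith

/-! ### Maximum over actions -/

section MaxQ

variable {S A : Type*} [Fintype A] [Nonempty A]

theorem le_maxQ (q : S → A → ℝ) (x : S) (b : A) : q x b ≤ maxQ q x :=
  Finset.le_sup' (fun b => q x b) (Finset.mem_univ b)

theorem exists_eq_maxQ (q : S → A → ℝ) (x : S) : ∃ b, q x b = maxQ q x := by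
  obtain ⟨b, -, hb⟩ := Finset.exists_mem_eq_sup' (Finset.univ_nonempty (α := A)) fun b => q x b
  exact ⟨b, hb.symm⟩

theorem maxQ_le_iff {q : S → A → ℝ} {x : S} {c : ℝ} : maxQ q x ≤ c ↔ ∀ b, q x b ≤ c := by
  simp [maxQ]

theorem maxQ_le_maxQ_add {q q' : S → A → ℝ} {x : S} {c : ℝ} (h : ∀ b, q x b ≤ q' x b + c) :
    maxQ q x ≤ maxQ q' x + c :=
  maxQ_le_iff.2 fun b => (h b).trans (by linarith [le_maxQ q' x b])

theorem maxQ_eq_zero {q : S → A → ℝ} {x : S} (h : ∀ b, q x b = 0) : maxQ q x = 0 := by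
  obtain ⟨b, hb⟩ := exists_eq_maxQ q x
  rw [← hb, h]

end MaxQ

/-! ### Transience, the Bellman equation in exponential form, comparison -/

section Deterministic

variable {S A : Type*} [Fintype S] [DecidableEq S]

namespace TransientMDP

theorem p_nonneg (M : TransientMDP S A) (x : S) (b : A) (y : S) : 0 ≤ M.p x b y :=
  (M.p_mem x b).1 y

theorem p_sum (M : TransientMDP S A) (x : S) (b : A) : ∑ y, M.p x b y = 1 :=
  (M.p_mem x b).2

theorem exists_p_pos (M : TransientMDP S A) (x : S) (b : A) : ∃ y, 0 < M.p x b y := by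
  by_contra! h
  have := Finset.sum_nonpos fun y (_ : y ∈ Finset.univ) => h y
  rw [M.p_sum] at this
  linarith

theorem p_sink_of_ne (M : TransientMDP S A) (b : A) {y : S} (hy : y ≠ M.e) : M.p M.e b y = 0 := by
  have h := M.p_sum M.e b
  rw [← Finset.add_sum_erase _ _ (Finset.mem_univ M.e), M.p_sink] at h
  have h0 : ∑ y ∈ Finset.univ.erase M.e, M.p M.e b y = 0 := by linarith
  exact (Finset.sum_eq_zero_iff_of_nonneg fun y _ => M.p_nonneg _ _ y).1 h0 y (by simp [hy])

/-- No set of states avoiding the sink is closed under a stationary policy. -/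
theorem eq_empty_of_closed (M : TransientMDP S A) (π : S → A) (X : Set S) (he : M.e ∉ X)
    (hX : ∀ x ∈ X, ∀ y, 0 < M.p x (π x) y → y ∈ X) : X = ∅ := by
  classical
  by_contra hne
  obtain ⟨x, hx⟩ := Set.nonempty_iff_ne_empty.2 hne
  have hsupp : ∀ t y, y ∉ X → stateProb M.p π x t y = 0 := by
    intro t
    induction t with
    | zero =>
      intro y hy
      have : y ≠ x := fun h => hy (h ▸ hx)
      simp [stateProb, this]
    | succ t ih =>
      intro y hy
      refine Finset.sum_eq_zero fun w _ => ?_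
      by_cases hw : w ∈ X
      · have : ¬ 0 < M.p w (π w) y := fun h => hy (hX w hw y h)
        rw [le_antisymm (not_lt.1 this) (M.p_nonneg _ _ _), mul_zero]
      · rw [ih w hw, zero_mul]
  have hsum : ∀ t, ∑ y, stateProb M.p π x t y = 1 := by
    intro t
    induction t with
    | zero => simp [stateProb]
    | succ t ih =>
      simp only [stateProb]
      rw [Finset.sum_comm]
      simp [← Finset.mul_sum, M.p_sum, ih]
  -- The chain stays in `X`, where expected visit counts are finite, yet its total mass is 1 at
  -- every time.
  have h1 : Summable fun t => ∑ y, stateProb M.p π x t y := by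
    refine summable_sum fun y _ => ?_
    by_cases hy : y ∈ X
    · exact M.transient π x y (fun h => he (h ▸ hx)) (fun h => he (h ▸ hy))
    · simp [hsupp _ y hy, summable_zero]
  simp [hsum, summable_const_iff] at h1

end TransientMDP

variable [Fintype A] [Nonempty A]

/-- The Bellman backup of the exponentially transformed values. -/
def expBackup (M : TransientMDP S A) (β : ℝ) (q : S → A → ℝ) (x : S) (b : A) : ℝ :=
  ∑ y, M.p x b y * Real.exp (-β * (M.r x b y + maxQ q y))

theorem expBackup_pos (M : TransientMDP S A) (β : ℝ) (q : S → A → ℝ) (x : S) (b : A) :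
    0 < expBackup M β q x b := by
  obtain ⟨y, hy⟩ := M.exists_p_pos x b
  exact Finset.sum_pos' (fun y _ => mul_nonneg (M.p_nonneg _ _ _) (Real.exp_pos _).le)
    ⟨y, Finset.mem_univ _, mul_pos hy (Real.exp_pos _)⟩

/-- With `c = q x b` the exponents are `-β` times the TD residuals, so the left side is the
conditional mean that drives the update. -/
theorem exp_mul_expBackup (M : TransientMDP S A) (β : ℝ) (q : S → A → ℝ) (x : S) (b : A) (c : ℝ) :
    Real.exp (β * c) * expBackup M β q x b =
      ∑ y, M.p x b y * Real.exp (-β * (M.r x b y + maxQ q y - c)) := by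
  rw [expBackup, Finset.mul_sum]
  refine Finset.sum_congr rfl fun y _ => ?_
  rw [mul_left_comm, ← Real.exp_add]
  ring_nf

/-- The backup is antitone in the table, and a shift of the table by `c` multiplies it by `exp (-β
c)`. -/
theorem expBackup_le_of_le_add (M : TransientMDP S A) {β : ℝ} (hβ : 0 < β) {q q' : S → A → ℝ}
    {c : ℝ} (h : ∀ x b, q x b ≤ q' x b + c) (x : S) (b : A) :
    expBackup M β q' x b ≤ Real.exp (β * c) * expBackup M β q x b := by
  rw [exp_mul_expBackup]
  refine Finset.sum_le_sum fun y _ => mul_le_mul_of_nonneg_left (Real.exp_le_exp.2 ?_)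
    (M.p_nonneg _ _ _)
  nlinarith [maxQ_le_maxQ_add (h y)]

theorem expBackup_sink (M : TransientMDP S A) (β : ℝ) {q : S → A → ℝ}
    (hq : ∀ b, q M.e b = 0) (b : A) : expBackup M β q M.e b = 1 := by
  rw [expBackup, Finset.sum_eq_single M.e]
  · simp [M.p_sink, M.r_sink, maxQ_eq_zero hq]
  · intro y _ hy
    rw [M.p_sink_of_ne b hy, zero_mul]
  · simp

/-- Up to a constant the loss is `β⁻¹ exp (β (y - z)) - y`, so `t + 1 ≤ exp t` makes `z` a
minimiser; by uniqueness it is the one chosen by `Classical.epsilon`. -/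
theorem ermBellman_eq (M : TransientMDP S A) {β : ℝ} (hβ : 0 < β) (q : S → A → ℝ) (x : S) (b : A) :
    ermBellman M β q x b = -β⁻¹ * Real.log (expBackup M β q x b) := by
  set z := -β⁻¹ * Real.log (expBackup M β q x b) with hz
  have hC := expBackup_pos M β q x b
  have hu := existsUnique_isMinOn_bellmanLoss M hβ q x b
  have hloss : ∀ y, bellmanLoss M β q x b y = β⁻¹ * Real.exp (β * (y - z)) - y +
      ((∑ s', M.p x b s' * (M.r x b s' + maxQ q s')) - β⁻¹) := by
    intro y
    have h1 : Real.exp (β * (y - z)) = Real.exp (β * y) * expBackup M β q x b := by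
      nth_rw 1 [← Real.exp_log hC]
      rw [← Real.exp_add, hz]
      congr 1
      field_simp
      ring
    rw [h1, exp_mul_expBackup, Finset.mul_sum]
    have h2 : (β⁻¹ + y) = ∑ s', M.p x b s' * (β⁻¹ + y) := by
      rw [← Finset.sum_mul, M.p_sum, one_mul]
    have h3 : ∀ u v : ℝ, u - y + (v - β⁻¹) = u + v - (β⁻¹ + y) := by intros; ring
    rw [h3, h2, ← Finset.sum_add_distrib, ← Finset.sum_sub_distrib, bellmanLoss]
    refine Finset.sum_congr rfl fun s' _ => ?_
    rw [ermLoss]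
    ring
  have hmin : IsMinOn (bellmanLoss M β q x b) Set.univ z := by
    intro y _
    change bellmanLoss M β q x b z ≤ bellmanLoss M β q x b y
    rw [hloss, hloss, sub_self, mul_zero, Real.exp_zero]
    have h1 := mul_le_mul_of_nonneg_left (Real.add_one_le_exp (β * (y - z))) (inv_pos.2 hβ).le
    have h2 : β⁻¹ * (β * (y - z) + 1) = y - z + β⁻¹ := by field_simp
    linarith
  exact hu.unique (Classical.epsilon_spec hu.exists) hmin

theorem eq_ermBellman_iff (M : TransientMDP S A) {β : ℝ} (hβ : 0 < β) {q : S → A → ℝ} :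
    q = ermBellman M β q ↔ ∀ x b, Real.exp (-β * q x b) = expBackup M β q x b := by
  have key : ∀ x b, q x b = ermBellman M β q x b ↔
      Real.exp (-β * q x b) = expBackup M β q x b := by
    intro x b
    rw [ermBellman_eq M hβ, ← Real.exp_log (expBackup_pos M β q x b), Real.exp_eq_exp, Real.log_exp]
    constructor <;> intro h
    · rw [h]; field_simp
    · rw [← h]; field_simp
  simp only [funext_iff, key]

/-- Comparison principle: a subsolution of the Bellman equation lies below a supersolution. -/
theorem le_of_expBackup_le (M : TransientMDP S A) {β : ℝ} (hβ : 0 < β) {U L : S → A → ℝ}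
    (hUe : ∀ b, U M.e b = 0) (hLe : ∀ b, L M.e b = 0)
    (hU : ∀ x b, x ≠ M.e → expBackup M β U x b ≤ Real.exp (-β * U x b))
    (hL : ∀ x b, x ≠ M.e → Real.exp (-β * L x b) ≤ expBackup M β L x b) (x : S) (b : A) :
    U x b ≤ L x b := by
  have : Nonempty S := ⟨M.e⟩
  obtain ⟨⟨x₀, b₀⟩, hmax⟩ := Finite.exists_max fun z : S × A => U z.1 z.2 - L z.1 z.2
  set c := U x₀ b₀ - L x₀ b₀ with hc
  have hmax' : ∀ x b, U x b ≤ L x b + c := fun x b => by linarith [hmax (x, b)]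
  suffices c ≤ 0 by linarith [hmax' x b]
  by_contra! hcpos
  -- At a maximiser of `U - L` the chain `backup L ≤ exp (β c) * backup U ≤ exp (-β L) ≤ backup L`
  -- closes up, so every term of positive weight is an equality.
  have hsucc : ∀ x b, U x b = L x b + c → ∀ y, 0 < M.p x b y → maxQ U y = maxQ L y + c := by
    intro x b hxb y hy
    have hxe : x ≠ M.e := by
      rintro rfl
      rw [hUe, hLe] at hxb
      linarith
    have h1 : Real.exp (-β * L x b) = Real.exp (β * c) * Real.exp (-β * U x b) := by
      rw [← Real.exp_add, hxb]; ring_nf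
    have hle : ∀ y ∈ Finset.univ, M.p x b y * Real.exp (-β * (M.r x b y + maxQ L y)) ≤
        M.p x b y * Real.exp (-β * (M.r x b y + maxQ U y - c)) := fun y _ =>
      mul_le_mul_of_nonneg_left (Real.exp_le_exp.2 (by nlinarith [maxQ_le_maxQ_add (hmax' y)]))
        (M.p_nonneg _ _ _)
    have heq : expBackup M β L x b =
        ∑ y, M.p x b y * Real.exp (-β * (M.r x b y + maxQ U y - c)) := by
      refine le_antisymm (Finset.sum_le_sum hle) ?_
      rw [← exp_mul_expBackup]
      refine le_trans ?_ (hL x b hxe)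
      rw [h1]
      exact mul_le_mul_of_nonneg_left (hU x b hxe) (Real.exp_pos _).le
    have h2 := (Finset.sum_eq_sum_iff_of_le hle).1 heq y (Finset.mem_univ _)
    have h3 := Real.exp_injective (mul_left_cancel₀ hy.ne' h2)
    have h4 := mul_left_cancel₀ (neg_ne_zero.2 hβ.ne') h3
    linarith
  -- If `maxQ U` exceeds `maxQ L` by `c` at `x`, a `U`-greedy action maximises `U - L`; its
  -- successors then have the same gap.
  choose π hπ using exists_eq_maxQ U
  have hempty := M.eq_empty_of_closed π {x | maxQ U x = maxQ L x + c}
    (by simp [maxQ_eq_zero hUe, maxQ_eq_zero hLe, hcpos.ne]) fun x hx y hy =>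
      hsucc x (π x) (le_antisymm (hmax' _ _) (by
        rw [hπ x, hx]; linarith [le_maxQ L x (π x)])) y hy
  obtain ⟨y, hy⟩ := M.exists_p_pos x₀ b₀
  have : y ∈ {x | maxQ U x = maxQ L x + c} := hsucc x₀ b₀ (by rw [hc]; ring) y hy
  simp [hempty] at this

/-- This makes the pathwise limit independent of the path. The value at the sink must be prescribed,
since adding a constant to a fixed point gives another one. -/
theorem fixedPoint_unique (M : TransientMDP S A) {β : ℝ} (hβ : 0 < β)
    {Q Q' : S → A → ℝ} (he : ∀ b, Q M.e b = 0)
    (he' : ∀ b, Q' M.e b = 0) (h : Q = ermBellman M β Q) (h' : Q' = ermBellman M β Q') :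
    Q = Q' := by
  rw [eq_ermBellman_iff M hβ] at h h'
  funext x b
  exact le_antisymm
    (le_of_expBackup_le M hβ he he' (fun x b _ => (h x b).ge) (fun x b _ => (h' x b).le) x b)
    (le_of_expBackup_le M hβ he' he (fun x b _ => (h' x b).ge) (fun x b _ => (h x b).le) x b)

end Deterministic

/-! ### Pathwise analysis: boundedness and convergence along one realisation -/

section Pathwise

variable {S A : Type*} [Fintype S] [DecidableEq S] [Fintype A] [DecidableEq A] [Nonempty A]

/-- The step size applied to the entry `(x, b)`: zero unless `(x, b)` is visited. -/
def visitStep {S A : Type*} [DecidableEq S] [DecidableEq A] (η : ℕ → ℝ) (s : ℕ → S) (a : ℕ → A)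
    (x : S) (b : A) (i : ℕ) : ℝ :=
  if s i = x ∧ a i = b then η i else 0

theorem visitStep_nonneg {S A : Type*} [DecidableEq S] [DecidableEq A] {η : ℕ → ℝ}
    (hη : ∀ i, 0 ≤ η i) (s : ℕ → S) (a : ℕ → A) (x : S) (b : A) (i : ℕ) :
    0 ≤ visitStep η s a x b i := by
  unfold visitStep
  split_ifs
  exacts [hη i, le_rfl]

theorem RobbinsMonroAt.summable_sq {S A : Type*} [DecidableEq S] [DecidableEq A] {η : ℕ → ℝ}
    {s : ℕ → S} {a : ℕ → A} {x : S} {b : A} (h : RobbinsMonroAt η s a x b) :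
    Summable fun i => visitStep η s a x b i ^ 2 := by
  simpa [visitStep, ite_pow] using h.2

theorem RobbinsMonroAt.tendsto_visitStep {S A : Type*} [DecidableEq S] [DecidableEq A]
    {η : ℕ → ℝ} {s : ℕ → S} {a : ℕ → A} {x : S} {b : A} (h : RobbinsMonroAt η s a x b) :
    Tendsto (visitStep η s a x b) atTop (𝓝 0) := by
  have h1 := h.summable_sq.tendsto_atTop_zero
  have h2 := h1.sqrt
  simp only [Real.sqrt_sq_eq_abs, Real.sqrt_zero] at h2
  exact (tendsto_zero_iff_abs_tendsto_zero _).2 h2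

/-- The Q-learning iterates without the check of the TD residual. -/
def freeIterates (M : TransientMDP S A) (β : ℝ) (η : ℕ → ℝ) (s : ℕ → S) (a : ℕ → A)
    (s' : ℕ → S) : ℕ → S → A → ℝ
  | 0 => fun _ _ => 0
  | i + 1 => fun x b => freeIterates M β η s a s' i x b - visitStep η s a x b i *
      (Real.exp (-β * tdResidual M (freeIterates M β η s a s' i) x b (s' i)) - 1)

theorem freeIterates_succ (M : TransientMDP S A) (β : ℝ) (η : ℕ → ℝ) (s : ℕ → S) (a : ℕ → A)
    (s' : ℕ → S) (i : ℕ) (x : S) (b : A) :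
    freeIterates M β η s a s' (i + 1) x b =
      freeIterates M β η s a s' i x b - visitStep η s a x b i *
        (Real.exp (-β * tdResidual M (freeIterates M β η s a s' i) x b (s' i)) - 1) :=
  rfl

/-- The return branch is never taken. For unvisited pairs the residual formed with `s' i` has no
meaning, but it is multiplied by a zero step. -/
theorem ermQLearning_eq_freeIterates (M : TransientMDP S A) (β zmin zmax : ℝ) {η : ℕ → ℝ}
    {s : ℕ → S} {a : ℕ → A} {s' : ℕ → S}
    (hz : ∀ i q, ermQLearning M β zmin zmax η s a s' i = QState.running q →
      tdResidual M q (s i) (a i) (s' i) ∈ Set.Icc zmin zmax) (i : ℕ) :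
    ermQLearning M β zmin zmax η s a s' i = QState.running (freeIterates M β η s a s' i) := by
  induction i with
  | zero => rfl
  | succ i ih =>
    rw [ermQLearning, ih, ermQStep, if_pos (hz i _ ih)]
    congr 1
    funext x b
    rw [freeIterates_succ, visitStep]
    by_cases h : x = s i ∧ b = a i
    · obtain ⟨rfl, rfl⟩ := h
      simp
    · have h' : ¬ (s i = x ∧ a i = b) := fun hh => h ⟨hh.1.symm, hh.2.symm⟩
      simp [h, h']

/-- The sequence moves only when it is at most `K`, and then rises by at most `D`, so it never
passes `max (u 0) (K + D)`. -/
theorem exists_bound_of_visits {u : ℕ → ℝ} {K D : ℝ}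
    (h : ∀ i, u (i + 1) = u i ∨ u i ≤ K ∧ u (i + 1) ≤ u i + D) : ∃ K', ∀ i, u i ≤ K' := by
  refine ⟨max (u 0) (K + D), fun i => ?_⟩
  induction i with
  | zero => exact le_max_left _ _
  | succ i ih =>
    rcases h i with h | ⟨h1, h2⟩
    · rwa [h]
    · exact (by linarith : u (i + 1) ≤ K + D).trans (le_max_right _ _)

theorem exists_forall_le_of_finite {ι : Type*} [Finite ι] {u : ι → ℕ → ℝ} {p : ι → Prop}
    (h : ∀ j, p j → ∃ K, ∀ i, u j i ≤ K) : ∃ K, ∀ j, p j → ∀ i, u j i ≤ K := by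
  have h' : ∀ j, ∃ K, p j → ∀ i, u j i ≤ K := fun j => by
    by_cases hj : p j
    · exact (h j hj).imp fun K hK _ => hK
    · exact ⟨0, fun hh => absurd hh hj⟩
  choose K hK using h'
  obtain ⟨C, hC⟩ := Set.Finite.bddAbove (Set.finite_range K)
  exact ⟨C, fun j hj i => (hK j hj i).trans (hC ⟨j, rfl⟩)⟩

variable (M : TransientMDP S A) {β zmin zmax : ℝ} {η : ℕ → ℝ} {s : ℕ → S} {a : ℕ → A} {s' : ℕ → S}

/-- From the sink only the sink can be sampled, with residual 0 and increment 0; hence no step-size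
condition is needed there. -/
theorem freeIterates_sink (hpos : ∀ i, 0 < M.p (s i) (a i) (s' i)) (i : ℕ) (b : A) :
    freeIterates M β η s a s' i M.e b = 0 := by
  induction i generalizing b with
  | zero => rfl
  | succ i ih =>
    rw [freeIterates_succ, visitStep, ih]
    split_ifs with h
    · have hs' : s' i = M.e := by
        by_contra hne
        have := hpos i
        rw [h.1, M.p_sink_of_ne _ hne] at this
        exact this.false
      simp [tdResidual, hs', M.r_sink, maxQ_eq_zero ih, ih]
    · simp

/-- TD residuals that are bounded on the support of the transitions keep the iterates bounded. -/
theorem exists_abs_freeIterates_le (hβ : 0 < β) (hη : ∀ i, 0 ≤ η i)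
    (hsteps : ∀ x b, x ≠ M.e → RobbinsMonroAt η s a x b)
    (hpos : ∀ i, 0 < M.p (s i) (a i) (s' i))
    (hz : ∀ i y, 0 < M.p (s i) (a i) y →
      tdResidual M (freeIterates M β η s a s' i) (s i) (a i) y ∈ Set.Icc zmin zmax) :
    ∃ K, ∀ i x b, |freeIterates M β η s a s' i x b| ≤ K := by
  set q := freeIterates M β η s a s' with hq
  obtain ⟨R, hR⟩ := Set.Finite.bddAbove
    (Set.finite_range fun z : S × A × S => |M.r z.1 z.2.1 z.2.2|)
  replace hR : ∀ x b y, |M.r x b y| ≤ R := fun x b y => hR ⟨(x, b, y), rfl⟩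
  have hsink : ∀ i b, q i M.e b = 0 := freeIterates_sink M hpos
  -- Step sizes tend to 0 along visits, hence are bounded, and `zmin` bounds the exponential.
  obtain ⟨D, hD⟩ : ∃ D, ∀ x b, x ≠ M.e → ∀ i, s i = x ∧ a i = b →
      |q (i + 1) x b - q i x b| ≤ D := by
    have h1 : ∀ z : S × A, z.1 ≠ M.e → ∃ K, ∀ i, visitStep η s a z.1 z.2 i ≤ K := fun z hz => by
      obtain ⟨K, hK⟩ := (hsteps z.1 z.2 hz).tendsto_visitStep.bddAbove_range
      exact ⟨K, fun i => hK ⟨i, rfl⟩⟩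
    obtain ⟨E, hE⟩ := exists_forall_le_of_finite h1
    refine ⟨E * (Real.exp (-β * zmin) + 1), fun x b hx i hi => ?_⟩
    have h2 := (hz i (s' i) (hpos i)).1
    rw [hi.1, hi.2] at h2
    have h3 : Real.exp (-β * tdResidual M (q i) x b (s' i)) ≤ Real.exp (-β * zmin) :=
      Real.exp_le_exp.2 (by nlinarith)
    have h4 := Real.exp_pos (-β * tdResidual M (q i) x b (s' i))
    rw [hq, freeIterates_succ, ← hq, sub_sub_cancel_left, abs_neg, abs_mul,
      abs_of_nonneg (visitStep_nonneg hη s a x b i)]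
    refine mul_le_mul (hE (x, b) hx i) ?_ (abs_nonneg _)
      ((visitStep_nonneg hη s a x b i).trans (hE (x, b) hx i))
    rw [abs_le]
    constructor <;> linarith
  have hstay : ∀ x b i, ¬ (s i = x ∧ a i = b) → q (i + 1) x b = q i x b := fun x b i h => by
    rw [hq, freeIterates_succ, visitStep, if_neg h, zero_mul, sub_zero]
  -- Let `π` pick an action whose value is unbounded above wherever the maximum is. At a visit
  -- `zmin` bounds `q(x, π x)` by a constant plus the maximum at any successor, so every successor
  -- is unbounded above too.
  have hupper : ∀ x, ∃ K, ∀ i, maxQ (q i) x ≤ K := by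
    by_contra! hno
    obtain ⟨x₀, hx₀⟩ := hno
    have hsel : ∀ x, ∃ b, (∀ K, ∃ i, K < maxQ (q i) x) → ∀ K, ∃ i, K < q i x b := fun x => by
      by_contra! h
      obtain ⟨hx, h⟩ := forall_and.1 h
      obtain ⟨K, hK⟩ := exists_forall_le_of_finite (p := fun _ => True)
        (u := fun b i => q i x b) fun b _ => h b
      obtain ⟨i, hi⟩ := hx (Classical.arbitrary A) K
      exact absurd hi (not_lt.2 (maxQ_le_iff.2 fun b => hK b trivial i))
    choose π hπ using hsel
    have hempty := M.eq_empty_of_closed π {x | ∀ K, ∃ i, K < maxQ (q i) x} (by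
      intro h
      obtain ⟨i, hi⟩ := h 0
      rw [maxQ_eq_zero (hsink i)] at hi
      exact hi.false) (by
      intro x hx y hy
      by_contra hyn
      have hxe : x ≠ M.e := by
        rintro rfl
        obtain ⟨i, hi⟩ := hx 0
        rw [maxQ_eq_zero (hsink i)] at hi
        exact hi.false
      simp only [Set.mem_ofPred_eq, not_forall, not_exists, not_lt] at hyn
      obtain ⟨C, hC⟩ := hyn
      obtain ⟨K', hK'⟩ := exists_bound_of_visits (u := fun i => q i x (π x))
        (K := R + C - zmin) (D := D) fun i => by
          by_cases hv : s i = x ∧ a i = π x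
          · right
            have h1 := (hz i y (by rw [hv.1, hv.2]; exact hy)).1
            rw [hv.1, hv.2, tdResidual] at h1
            have h2 := (abs_le.1 (hD x (π x) hxe i hv)).2
            have h3 := (abs_le.1 (hR x (π x) y)).2
            have h4 := hC i
            constructor <;> linarith
          · exact Or.inl (hstay _ _ _ hv)
      obtain ⟨i, hi⟩ := hπ x hx K'
      exact absurd hi (not_lt.2 (hK' i)))
    have : x₀ ∈ {x | ∀ K, ∃ i, K < maxQ (q i) x} := hx₀
    simp [hempty] at this
  have hlowerAt : ∀ x b y, x ≠ M.e → 0 < M.p x b y → (∃ C, ∀ i, C ≤ maxQ (q i) y) →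
      ∃ K, ∀ i, -q i x b ≤ K := by
    rintro x b y hxe hy ⟨C, hC⟩
    refine exists_bound_of_visits (K := zmax + R - C) (D := D) fun i => ?_
    by_cases hv : s i = x ∧ a i = b
    · right
      have h1 := (hz i y (by rw [hv.1, hv.2]; exact hy)).2
      rw [hv.1, hv.2, tdResidual] at h1
      have h2 := (abs_le.1 (hD x b hxe i hv)).1
      have h3 := (abs_le.1 (hR x b y)).1
      have h4 := hC i
      constructor <;> linarith
    · exact Or.inl (by rw [hstay _ _ _ hv])
  -- Where the maximum is unbounded below, so is every action value; hence any policy serves, and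
  -- `zmax` passes the unboundedness to the successors.
  have hlower : ∀ x, ∃ C, ∀ i, C ≤ maxQ (q i) x := by
    by_contra! hno
    obtain ⟨x₀, hx₀⟩ := hno
    have hempty := M.eq_empty_of_closed (fun _ => Classical.arbitrary A)
      {x | ∀ C, ∃ i, maxQ (q i) x < C} (by
      intro h
      obtain ⟨i, hi⟩ := h 0
      rw [maxQ_eq_zero (hsink i)] at hi
      exact hi.false) (by
      intro x hx y hy
      by_contra hyn
      have hxe : x ≠ M.e := by
        rintro rfl
        obtain ⟨i, hi⟩ := hx 0
        rw [maxQ_eq_zero (hsink i)] at hi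
        exact hi.false
      simp only [Set.mem_ofPred_eq, not_forall, not_exists, not_lt] at hyn
      obtain ⟨K, hK⟩ := hlowerAt x _ y hxe hy hyn
      obtain ⟨i, hi⟩ := hx (-K)
      linarith [hK i, le_maxQ (q i) x (Classical.arbitrary A)])
    have : x₀ ∈ {x | ∀ C, ∃ i, maxQ (q i) x < C} := hx₀
    simp [hempty] at this
  obtain ⟨K₁, hK₁⟩ := exists_forall_le_of_finite (p := fun _ => True)
    (u := fun x i => maxQ (q i) x) fun x _ => hupper x
  obtain ⟨K₂, hK₂⟩ := exists_forall_le_of_finite (p := fun _ => True)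
    (u := fun (z : S × A) i => -q i z.1 z.2) fun z _ => by
      obtain ⟨x, b⟩ := z
      by_cases hxe : x = M.e
      · exact ⟨0, fun i => by simp [hxe, hsink]⟩
      · obtain ⟨y, hy⟩ := M.exists_p_pos x b
        exact hlowerAt x b y hxe hy (hlower y)
  refine ⟨max K₁ K₂, fun i x b => abs_le.2 ⟨?_, ?_⟩⟩
  · linarith [hK₂ (x, b) trivial i, le_max_right K₁ K₂]
  · linarith [hK₁ x trivial i, le_max_left K₁ K₂, le_maxQ (q i) x b]

/-- Bounded iterates with convergent noise converge to a fixed point. -/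
theorem exists_tendsto_of_noise (hβ : 0 < β) (hη : ∀ i, 0 ≤ η i)
    (hsteps : ∀ x b, x ≠ M.e → RobbinsMonroAt η s a x b) {q : ℕ → S → A → ℝ}
    (hsink : ∀ i b, q i M.e b = 0) {n : S → A → ℕ → ℝ}
    (hrec : ∀ i x b, q (i + 1) x b = q i x b - visitStep η s a x b i *
      (Real.exp (β * q i x b) * expBackup M β (q i) x b - 1) + n x b i)
    (hn : ∀ x b, x ≠ M.e → ∃ l, Tendsto (fun k => ∑ i ∈ Finset.range k, n x b i) atTop (𝓝 l))
    (hbdd : ∃ K, ∀ i x b, |q i x b| ≤ K) :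
    ∃ Q : S → A → ℝ, (∀ b, Q M.e b = 0) ∧ Q = ermBellman M β Q ∧
      ∀ x b, Tendsto (fun i => q i x b) atTop (𝓝 (Q x b)) := by
  obtain ⟨K, hK⟩ := hbdd
  have hba : ∀ x b, IsBoundedUnder (· ≤ ·) atTop fun i => q i x b := fun x b =>
    isBoundedUnder_of ⟨K, fun i => (abs_le.1 (hK i x b)).2⟩
  have hbb : ∀ x b, IsBoundedUnder (· ≥ ·) atTop fun i => q i x b := fun x b =>
    isBoundedUnder_of ⟨-K, fun i => (abs_le.1 (hK i x b)).1⟩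
  set U : S → A → ℝ := fun x b => limsup (fun i => q i x b) atTop with hU
  set L : S → A → ℝ := fun x b => liminf (fun i => q i x b) atTop with hL
  have hUe : ∀ b, U M.e b = 0 := fun b => by simp [hU, hsink]
  have hLe : ∀ b, L M.e b = 0 := fun b => by simp [hL, hsink]
  have hlt : ∀ ε > 0, ∀ᶠ i in atTop, ∀ x b, q i x b ≤ U x b + ε := fun ε hε => by
    simp only [eventually_all]
    intro x b
    exact (eventually_lt_of_limsup_lt (lt_add_of_pos_right _ hε) (hba x b)).mono fun _ h => h.le
  have hgt : ∀ ε > 0, ∀ᶠ i in atTop, ∀ x b, L x b ≤ q i x b + ε := fun ε hε => by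
    simp only [eventually_all]
    intro x b
    exact (eventually_lt_of_lt_liminf (sub_lt_self _ hε) (hbb x b)).mono fun i h =>
      by linarith [show L x b - ε < q i x b from h]
  -- The backup is `exp (-β Y)`, with `Y` the Bellman value; `Y` is the drift threshold below.
  have hfac : ∀ (Q : S → A → ℝ) x b, expBackup M β Q x b =
      Real.exp (-β * (-β⁻¹ * Real.log (expBackup M β Q x b))) := fun Q x b => by
    rw [show -β * (-β⁻¹ * Real.log (expBackup M β Q x b)) = Real.log (expBackup M β Q x b) by
      field_simp, Real.exp_log (expBackup_pos M β Q x b)]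
  -- The drift is always at least `-1`, but the argument for `-q` needs an upper bound as well.
  have hgle : ∀ x b, ∃ C, ∀ i, Real.exp (β * q i x b) * expBackup M β (q i) x b - 1 ≤ C := by
    intro x b
    refine ⟨Real.exp (β * K) * (Real.exp (β * K) * expBackup M β (fun _ _ => 0) x b) - 1,
      fun i => ?_⟩
    refine sub_le_sub_right (mul_le_mul (Real.exp_le_exp.2 ?_) ?_
      (expBackup_pos M β _ x b).le (Real.exp_pos _).le) 1
    · nlinarith [(abs_le.1 (hK i x b)).2]
    · exact expBackup_le_of_le_add M hβ (fun x b => by linarith [(abs_le.1 (hK i x b)).1]) x b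
  have hUsub : ∀ x b, x ≠ M.e → expBackup M β U x b ≤ Real.exp (-β * U x b) := by
    intro x b hx
    set Y := -β⁻¹ * Real.log (expBackup M β U x b) with hY
    obtain ⟨l, hl⟩ := hn x b hx
    have hev : ∀ ε > 0, ∀ᶠ i in atTop, q i x b ≤ Y + ε := fun ε hε => by
      refine eventually_le_of_drift (K := 1) (fun i => hrec i x b) (visitStep_nonneg hη s a x b)
        (hsteps x b hx).tendsto_visitStep (hsteps x b hx).1 hl (fun i => ?_) ?_ hε
      · linarith [mul_pos (Real.exp_pos (β * q i x b)) (expBackup_pos M β (q i) x b)]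
      · intro ε hε
        -- Replacing `q i` by `U` in the backup costs `ε / 2` of the excess `ε` over `Y`; the other
        -- half is the drift.
        refine ⟨Real.exp (β * (ε / 2)) - 1, by
          rw [gt_iff_lt, sub_pos, Real.one_lt_exp_iff]; positivity, ?_⟩
        filter_upwards [hlt (ε / 2) (by positivity)] with i hi hxi
        have h1 := expBackup_le_of_le_add M hβ hi x b
        rw [hfac U, ← hY] at h1
        have h2 : Real.exp (β * (ε / 2)) = Real.exp (β * (Y + ε)) * (Real.exp (-(β * (ε / 2))) *
            Real.exp (-β * Y)) := by
          rw [← Real.exp_add, ← Real.exp_add]; ring_nf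
        have h3 : Real.exp (-(β * (ε / 2))) * Real.exp (-β * Y) ≤ expBackup M β (q i) x b := by
          rw [Real.exp_neg, inv_mul_le_iff₀ (Real.exp_pos _)]
          exact h1
        rw [h2]
        exact sub_le_sub_right (mul_le_mul (Real.exp_le_exp.2 (by nlinarith)) h3
          (by positivity) (Real.exp_pos _).le) 1
    have : U x b ≤ Y := le_of_forall_pos_le_add fun ε hε =>
      limsup_le_of_le (hbb x b).isCoboundedUnder_le (hev ε hε)
    rw [hfac U, ← hY]
    exact Real.exp_le_exp.2 (by nlinarith)
  have hLsup : ∀ x b, x ≠ M.e → Real.exp (-β * L x b) ≤ expBackup M β L x b := by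
    intro x b hx
    set Y := -β⁻¹ * Real.log (expBackup M β L x b) with hY
    obtain ⟨l, hl⟩ := hn x b hx
    obtain ⟨C, hC⟩ := hgle x b
    have hev : ∀ ε > 0, ∀ᶠ i in atTop, -q i x b ≤ -Y + ε := fun ε hε => by
      refine eventually_le_of_drift (x := fun i => -q i x b) (η := visitStep η s a x b)
        (g := fun i => -(Real.exp (β * q i x b) * expBackup M β (q i) x b - 1))
        (n := fun i => -n x b i) (K := C) (l := -l) (fun i => by rw [hrec]; ring)
        (visitStep_nonneg hη s a x b)
        (hsteps x b hx).tendsto_visitStep (hsteps x b hx).1 (by simpa using hl.neg)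
        (fun i => by linarith [hC i]) ?_ hε
      intro ε hε
      refine ⟨1 - Real.exp (-(β * (ε / 2))), by
        rw [gt_iff_lt, sub_pos, Real.exp_lt_one_iff]; simp; positivity, ?_⟩
      filter_upwards [hgt (ε / 2) (by positivity)] with i hi hxi
      have h1 := expBackup_le_of_le_add M hβ hi x b
      rw [hfac L, ← hY, ← Real.exp_add] at h1
      have h2 : Real.exp (-(β * (ε / 2))) = Real.exp (β * (Y - ε)) *
          Real.exp (β * (ε / 2) + -β * Y) := by
        rw [← Real.exp_add]; ring_nf
      have h3 := mul_le_mul (Real.exp_le_exp.2 (show β * q i x b ≤ β * (Y - ε) by nlinarith)) h1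
        (expBackup_pos M β _ x b).le (Real.exp_pos _).le
      rw [h2]
      linarith
    have : Y ≤ L x b := by
      refine le_of_forall_pos_le_add fun ε hε => ?_
      have := le_liminf_of_le (a := Y - ε) (hba x b).isCoboundedUnder_ge
        ((hev ε hε).mono fun i hi => by linarith)
      linarith [show Y - ε ≤ L x b from this]
    rw [hfac L, ← hY]
    exact Real.exp_le_exp.2 (by nlinarith)
  have hLU : L = U := by
    funext x b
    exact le_antisymm (liminf_le_limsup (hba x b) (hbb x b))
      (le_of_expBackup_le M hβ hUe hLe hUsub hLsup x b)
  refine ⟨U, hUe, (eq_ermBellman_iff M hβ).2 fun x b => ?_, fun x b =>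
    tendsto_of_liminf_eq_limsup (congrFun (congrFun hLU x) b) rfl (hba x b) (hbb x b)⟩
  by_cases hx : x = M.e
  · rw [hx, hUe, expBackup_sink M β hUe]; simp
  · exact le_antisymm (by have := hLsup x b hx; rwa [hLU] at this) (hUsub x b hx)

end Pathwise

/-! ### Almost sure convergence of martingale transforms -/

section MartingaleTransform

variable {Ω : Type*} {m0 : MeasurableSpace Ω} {P : Measure Ω} [IsProbabilityMeasure P]
  {ℱ : Filtration ℕ m0} {H ξ : ℕ → Ω → ℝ}

theorem integrable_of_abs_le {f : Ω → ℝ} (hf : Measurable f) {C : ℝ} (h : ∀ ω, |f ω| ≤ C) :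
    Integrable f P :=
  Integrable.of_bound hf.aestronglyMeasurable C (ae_of_all _ h)

/-- A martingale transform of bounded quadratic variation converges almost surely. -/
theorem ae_tendsto_sum_mul_of_sum_sq_le (hH : ∀ i, Measurable[ℱ i] (H i))
    (hξ : ∀ i, Measurable[ℱ (i + 1)] (ξ i)) (hξ1 : ∀ i ω, |ξ i ω| ≤ 1)
    (hξ0 : ∀ i, P[ξ i | ℱ i] =ᵐ[P] 0) {N : ℝ}
    (hN : ∀ k ω, ∑ i ∈ Finset.range k, H i ω ^ 2 ≤ N) :
    ∀ᵐ ω ∂P, ∃ l, Tendsto (fun k => ∑ i ∈ Finset.range k, H i ω * ξ i ω) atTop (𝓝 l) := by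
  set X : ℕ → Ω → ℝ := fun k ω => ∑ i ∈ Finset.range k, H i ω * ξ i ω with hX
  have hN0 : 0 ≤ N := by
    obtain ⟨ω⟩ := P.nonempty_of_neZero
    simpa using hN 0 ω
  have hHb : ∀ i ω, |H i ω| ≤ Real.sqrt N := fun i ω => by
    refine Real.abs_le_sqrt (le_trans ?_ (hN (i + 1) ω))
    exact Finset.single_le_sum (f := fun i => H i ω ^ 2) (fun j _ => sq_nonneg _)
      (Finset.self_mem_range_succ i)
  have hHξb : ∀ i ω, |H i ω * ξ i ω| ≤ Real.sqrt N := fun i ω => by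
    rw [abs_mul]
    nlinarith [hHb i ω, hξ1 i ω, abs_nonneg (H i ω), abs_nonneg (ξ i ω)]
  have hXb : ∀ k ω, |X k ω| ≤ k * Real.sqrt N := fun k ω => by
    refine (Finset.abs_sum_le_sum_abs _ _).trans ?_
    refine (Finset.sum_le_sum fun i _ => hHξb i ω).trans ?_
    simp
  have hXm : ∀ k, Measurable[ℱ k] (X k) := fun k =>
    Finset.measurable_sum _ fun i hi =>
      ((hH i).mono (ℱ.mono (Finset.mem_range.1 hi).le) le_rfl).mul
        ((hξ i).mono (ℱ.mono (Finset.mem_range.1 hi)) le_rfl)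
  have hH' : ∀ i, Measurable (H i) := fun i => (hH i).mono (ℱ.le _) le_rfl
  have hξ' : ∀ i, Measurable (ξ i) := fun i => (hξ i).mono (ℱ.le _) le_rfl
  have hX' : ∀ i, Measurable (X i) := fun i => (hXm i).mono (ℱ.le _) le_rfl
  have hξint : ∀ i, Integrable (ξ i) P := fun i => integrable_of_abs_le (hξ' i) (hξ1 i)
  have horth : ∀ i (G : Ω → ℝ), Measurable[ℱ i] G → Integrable (G * ξ i) P →
      P[G * ξ i | ℱ i] =ᵐ[P] 0 := fun i G hG hint => by
    filter_upwards [condExp_mul_of_stronglyMeasurable_left hG.stronglyMeasurable hint (hξint i),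
      hξ0 i] with ω h1 h2
    simp [h1, h2]
  have hHξint : ∀ i, Integrable (H i * ξ i) P := fun i =>
    integrable_of_abs_le ((hH' i).mul (hξ' i)) (hHξb i)
  have hsucc : ∀ k, X (k + 1) = X k + H k * ξ k := fun k => by
    funext ω
    simp [hX, Finset.sum_range_succ]
  have hXint : ∀ k, Integrable (X k) P := fun k => integrable_of_abs_le (hX' k) (hXb k)
  have hmart : Martingale X ℱ P := by
    refine martingale_of_condExp_sub_eq_zero_nat (fun k => (hXm k).stronglyMeasurable) hXint
      fun k => ?_
    rw [hsucc, add_sub_cancel_left]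
    exact horth k (H k) (hH k) (hHξint k)
  have hXsq : ∀ k, Integrable (fun ω => X k ω ^ 2) P := fun k =>
    integrable_of_abs_le ((hX' k).pow_const 2) (C := (k * Real.sqrt N) ^ 2) fun ω => by
      rw [abs_pow]; exact pow_le_pow_left₀ (abs_nonneg _) (hXb k ω) 2
  have hsumint : ∀ k, Integrable (fun ω => ∑ i ∈ Finset.range k, H i ω ^ 2) P := fun k =>
    integrable_of_abs_le (Finset.measurable_sum _ fun i _ => (hH' i).pow_const 2) (C := N)
      fun ω => by
        rw [abs_of_nonneg (Finset.sum_nonneg fun i _ => sq_nonneg _)]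
        exact hN k ω
  -- Increments are orthogonal to the past, so the second moment grows by at most the mean of `H k ^
  -- 2`.
  have hsq : ∀ k, ∫ ω, X k ω ^ 2 ∂P ≤ ∫ ω, ∑ i ∈ Finset.range k, H i ω ^ 2 ∂P := by
    intro k
    induction k with
    | zero => simp [hX]
    | succ k ih =>
      have hHsq : Integrable (fun ω => H k ω ^ 2) P :=
        integrable_of_abs_le ((hH' k).pow_const 2) (C := (Real.sqrt N) ^ 2) fun ω => by
          rw [abs_pow]; exact pow_le_pow_left₀ (abs_nonneg _) (hHb k ω) 2
      have hHξsq : Integrable (fun ω => (H k ω * ξ k ω) ^ 2) P :=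
        integrable_of_abs_le (((hH' k).mul (hξ' k)).pow_const 2) (C := (Real.sqrt N) ^ 2)
          fun ω => by
            rw [abs_pow]; exact pow_le_pow_left₀ (abs_nonneg _) (hHξb k ω) 2
      have hcross : Integrable ((X k * H k) * ξ k) P :=
        integrable_of_abs_le (((hX' k).mul (hH' k)).mul (hξ' k))
          (C := k * Real.sqrt N * Real.sqrt N) fun ω => by
            simp only [Pi.mul_apply]
            rw [mul_assoc, abs_mul]
            exact mul_le_mul (hXb k ω) (hHξb k ω) (abs_nonneg _) (by positivity)
      have h0 : ∫ ω, ((X k * H k) * ξ k) ω ∂P = 0 := by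
        rw [← integral_condExp (ℱ.le k),
          integral_congr_ae (horth k (X k * H k) ((hXm k).mul (hH k)) hcross)]
        simp
      have hexp : ∀ ω, X (k + 1) ω ^ 2 =
          X k ω ^ 2 + 2 * ((X k * H k) * ξ k) ω + (H k ω * ξ k ω) ^ 2 := fun ω => by
        rw [hsucc]
        simp only [Pi.add_apply, Pi.mul_apply]
        ring
      have hle : ∫ ω, (H k ω * ξ k ω) ^ 2 ∂P ≤ ∫ ω, H k ω ^ 2 ∂P :=
        integral_mono hHξsq hHsq fun ω => by
          have h1 := (sq_le_one_iff_abs_le_one _).2 (hξ1 k ω)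
          simp only
          rw [mul_pow]
          nlinarith [sq_nonneg (H k ω)]
      simp only [hexp, Finset.sum_range_succ]
      rw [integral_add (f := fun ω => X k ω ^ 2 + 2 * ((X k * H k) * ξ k) ω)
          ((hXsq k).add (hcross.const_mul 2)) hHξsq,
        integral_add (hXsq k) (hcross.const_mul 2), integral_const_mul, h0,
        integral_add (hsumint k) hHsq]
      linarith
  refine hmart.submartingale.exists_ae_tendsto_of_bdd (R := (1 + N).toNNReal) fun k => ?_
  rw [eLpNorm_one_eq_lintegral_enorm, ← ofReal_integral_norm_eq_lintegral_enorm (hXint k)]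
  refine ENNReal.ofReal_le_ofReal ?_
  calc ∫ ω, ‖X k ω‖ ∂P ≤ ∫ ω, 1 + X k ω ^ 2 ∂P :=
        integral_mono (hXint k).norm ((integrable_const 1).add (hXsq k)) fun ω => by
          simp only [Real.norm_eq_abs]
          nlinarith [sq_abs (X k ω), sq_nonneg (|X k ω| - 1), abs_nonneg (X k ω)]
    _ = 1 + ∫ ω, X k ω ^ 2 ∂P := by
        rw [integral_add (integrable_const 1) (hXsq k)]; simp
    _ ≤ 1 + ∫ _, N ∂P := by
        have := integral_mono (hsumint k) (integrable_const N) (hN k)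
        linarith [hsq k]
    _ = 1 + N := by simp

/-- A martingale transform with square-summable coefficients converges almost surely. -/
theorem ae_tendsto_sum_mul_of_summable_sq (hH : ∀ i, Measurable[ℱ i] (H i))
    (hξ : ∀ i, Measurable[ℱ (i + 1)] (ξ i)) (hξ1 : ∀ i ω, |ξ i ω| ≤ 1)
    (hξ0 : ∀ i, P[ξ i | ℱ i] =ᵐ[P] 0) (hsum : ∀ᵐ ω ∂P, Summable fun i => H i ω ^ 2) :
    ∀ᵐ ω ∂P, ∃ l, Tendsto (fun k => ∑ i ∈ Finset.range k, H i ω * ξ i ω) atTop (𝓝 l) := by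
  classical
  have hQm : ∀ i, Measurable[ℱ i] fun ω => ∑ j ∈ Finset.range (i + 1), H j ω ^ 2 := fun i =>
    Finset.measurable_sum _ fun j hj =>
      ((hH j).mono (ℱ.mono (Nat.lt_succ_iff.1 (Finset.mem_range.1 hj))) le_rfl).pow_const 2
  -- Truncation at level `N`. The sum includes index `i` itself, so the retained squares never
  -- exceed `N`; this stays `ℱ i`-measurable because `H i` is known before `ξ i`.
  set HN : ℕ → ℕ → Ω → ℝ := fun N i ω =>
    if ∑ j ∈ Finset.range (i + 1), H j ω ^ 2 ≤ N then H i ω else 0 with hHN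
  have hHNm : ∀ N i, Measurable[ℱ i] (HN N i) := fun N i =>
    Measurable.ite (hQm i measurableSet_Iic) (hH i)
      measurable_const
  have hbound : ∀ (N k : ℕ) ω, ∑ i ∈ Finset.range k, HN N i ω ^ 2 ≤ N := by
    intro N k ω
    induction k with
    | zero => simp
    | succ k ih =>
      rw [Finset.sum_range_succ]
      by_cases h : ∑ j ∈ Finset.range (k + 1), H j ω ^ 2 ≤ N
      · refine le_trans ?_ h
        rw [Finset.sum_range_succ]
        refine add_le_add (Finset.sum_le_sum fun i _ => ?_) ?_
        · simp only [hHN]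
          split_ifs
          exacts [le_rfl, by simp [sq_nonneg]]
        · simp [hHN, h]
      · simpa [hHN, h] using ih
  have hall := ae_all_iff.2 fun N =>
    ae_tendsto_sum_mul_of_sum_sq_le (hHNm N) hξ hξ1 hξ0 (hbound N)
  filter_upwards [hall, hsum] with ω h1 h2
  obtain ⟨N, hN⟩ := exists_nat_ge (∑' i, H i ω ^ 2)
  have heq : ∀ i, HN N i ω = H i ω := fun i =>
    if_pos ((h2.sum_le_tsum _ fun j _ => sq_nonneg _).trans hN)
  simpa [heq] using h1 N

end MartingaleTransform

/-! ### Measurability and null sets under conditioning -/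

section Measurability

theorem measurable_eval_of_finite {Ω S : Type*} [Finite S] [MeasurableSpace S]
    [MeasurableSingletonClass S] {m : MeasurableSpace Ω} {g : Ω → S} (hg : Measurable g)
    {f : S → Ω → ℝ} (hf : ∀ y, Measurable (f y)) : Measurable fun ω => f (g ω) ω := by
  classical
  have := Fintype.ofFinite S
  have h : (fun ω => f (g ω) ω) = fun ω => ∑ y, if g ω = y then f y ω else 0 := by
    funext ω
    simp
  rw [h]
  exact Finset.measurable_sum _ fun y _ =>
    Measurable.ite (hg (measurableSet_singleton y)) (hf y) measurable_const

theorem measurable_tdResidual {Ω S A : Type*} [Fintype S] [DecidableEq S] [Fintype A] [Nonempty A]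
    (M : TransientMDP S A) {m : MeasurableSpace Ω} {q : Ω → S → A → ℝ}
    (hq : ∀ x b, Measurable fun ω => q ω x b) (x : S) (b : A) (y : S) :
    Measurable fun ω => tdResidual M (q ω) x b y := by
  have h : Measurable fun ω => maxQ (q ω) y := by
    have := Finset.measurable_sup' (Finset.univ_nonempty (α := A))
      (f := fun c ω => q ω y c) fun c _ => hq y c
    convert this using 1
    funext ω
    simp [maxQ, Finset.sup'_apply]
  exact (measurable_const.add h).sub (hq x b)

/-- `f` and `g` have the same integral over `E`, and a nonnegative function vanishes almost
everywhere on `E` iff that integral is 0. This converts statements about sampled successors into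
statements about possible ones, and back. -/
theorem ae_eq_zero_iff_of_condExp {Ω : Type*} {m m0 : MeasurableSpace Ω} {P : Measure Ω}
    [IsFiniteMeasure P] (hm : m ≤ m0) {f g : Ω → ℝ} (hf : Integrable f P) (hf0 : ∀ ω, 0 ≤ f ω)
    (hg0 : ∀ ω, 0 ≤ g ω) (hfg : P[f | m] =ᵐ[P] g) {E : Set Ω} (hE : MeasurableSet[m] E) :
    (∀ᵐ ω ∂P, ω ∈ E → f ω = 0) ↔ ∀ᵐ ω ∂P, ω ∈ E → g ω = 0 := by
  have hg : Integrable g P := integrable_condExp.congr hfg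
  have hint : ∫ ω in E, f ω ∂P = ∫ ω in E, g ω ∂P := by
    rw [← setIntegral_condExp hm hf hE]
    exact integral_congr_ae (ae_restrict_of_ae hfg)
  have key : ∀ {h : Ω → ℝ}, Integrable h P → (∀ ω, 0 ≤ h ω) →
      ((∀ᵐ ω ∂P, ω ∈ E → h ω = 0) ↔ ∫ ω in E, h ω ∂P = 0) := fun {h} hh hh0 => by
    rw [setIntegral_eq_zero_iff_of_nonneg_ae (ae_of_all _ hh0) hh.integrableOn,
      ← ae_restrict_iff' (hm _ hE)]
    rfl
  rw [key hf hf0, key hg hg0, hint]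

end Measurability

/-! ### The filtration of sample histories -/

section SampleHistory

variable {Ω S A : Type*} [MeasurableSpace S] [MeasurableSpace A] {η : ℕ → Ω → ℝ} {s : ℕ → Ω → S}
  {a : ℕ → Ω → A} {s' : ℕ → Ω → S}

theorem comap_le_sampleHistory_succ (i : ℕ) :
    MeasurableSpace.comap (η i) inferInstance ⊔ MeasurableSpace.comap (s i) inferInstance ⊔
      MeasurableSpace.comap (a i) inferInstance ⊔ MeasurableSpace.comap (s' i) inferInstance ≤
      sampleHistory η s a s' (i + 1) :=
  le_sup_of_le_left (le_iSup₂_of_le i (Nat.lt_succ_self i) le_rfl)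

theorem sampleHistory_mono : Monotone (sampleHistory η s a s') := by
  refine monotone_nat_of_le_succ fun i => sup_le (iSup₂_le fun l hl =>
    le_sup_of_le_left (le_iSup₂_of_le l (hl.trans (Nat.lt_succ_self i)) le_rfl)) ?_
  refine le_trans (sup_le (sup_le ?_ ?_) ?_) (comap_le_sampleHistory_succ i)
  · exact le_sup_of_le_left (le_sup_of_le_left le_sup_right)
  · exact le_sup_of_le_left le_sup_right
  · exact le_sup_of_le_left (le_sup_of_le_left le_sup_left)

theorem measurable_state_sampleHistory (i : ℕ) : Measurable[sampleHistory η s a s' i] (s i) :=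
  measurable_iff_comap_le.2 (le_sup_of_le_right (le_sup_of_le_left le_sup_left))

theorem measurable_action_sampleHistory (i : ℕ) : Measurable[sampleHistory η s a s' i] (a i) :=
  measurable_iff_comap_le.2 (le_sup_of_le_right (le_sup_of_le_left le_sup_right))

theorem measurable_step_sampleHistory (i : ℕ) : Measurable[sampleHistory η s a s' i] (η i) :=
  measurable_iff_comap_le.2 (le_sup_of_le_right le_sup_right)

theorem measurable_next_sampleHistory (i : ℕ) :
    Measurable[sampleHistory η s a s' (i + 1)] (s' i) :=
  measurable_iff_comap_le.2 (le_sup_right.trans (comap_le_sampleHistory_succ i))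

/-- The filtration of the sample histories. -/
def sampleFiltration [m0 : MeasurableSpace Ω] (hη : ∀ i, Measurable (η i))
    (hs : ∀ i, Measurable (s i)) (ha : ∀ i, Measurable (a i)) (hs' : ∀ i, Measurable (s' i)) :
    Filtration ℕ m0 where
  seq := sampleHistory η s a s'
  mono' := sampleHistory_mono
  le' i := sup_le (iSup₂_le fun l _ => sup_le (sup_le (sup_le (hη l).comap_le (hs l).comap_le)
    (ha l).comap_le) (hs' l).comap_le)
    (sup_le (sup_le (hs i).comap_le (ha i).comap_le) (hη i).comap_le)

variable [MeasurableSingletonClass S] [MeasurableSingletonClass A]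

theorem measurable_visitStep [DecidableEq S] [DecidableEq A] (x : S) (b : A) (i : ℕ) :
    Measurable[sampleHistory η s a s' i] fun ω =>
      visitStep (fun i => η i ω) (fun i => s i ω) (fun i => a i ω) x b i :=
  Measurable.ite ((measurable_state_sampleHistory i (measurableSet_singleton x)).inter
    (measurable_action_sampleHistory i (measurableSet_singleton b)))
    (measurable_step_sampleHistory i) measurable_const

/-- The table at time `i` depends only on samples before `i`; the successor `s' i` enters at `i +
1`, so the table is known before `s' i` is drawn. -/
theorem measurable_freeIterates [Fintype S] [DecidableEq S] [Fintype A] [DecidableEq A]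
    [Nonempty A] (M : TransientMDP S A) (β : ℝ) (i : ℕ) (x : S) (b : A) :
    Measurable[sampleHistory η s a s' i] fun ω =>
      freeIterates M β (fun i => η i ω) (fun i => s i ω) (fun i => a i ω) (fun i => s' i ω) i
        x b := by
  induction i generalizing x b with
  | zero => exact measurable_const
  | succ i ih =>
    have hmono : sampleHistory η s a s' i ≤ sampleHistory η s a s' (i + 1) :=
      sampleHistory_mono (Nat.le_succ i)
    have htd := measurable_eval_of_finite (measurable_next_sampleHistory (η := η) (s := s) (a := a)
      (s' := s') i) fun y => (measurable_tdResidual M ih x b y).mono hmono le_rfl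
    exact ((ih x b).mono hmono le_rfl).sub (((measurable_visitStep x b i).mono hmono le_rfl).mul
      ((htd.const_mul (-β)).exp.sub measurable_const))

end SampleHistory

end

/-! ### Assembly: almost sure convergence to a nonrandom fixed point -/

theorem mainTheorem1 {S A Ω : Type*}
    [Fintype S] [DecidableEq S] [MeasurableSpace S] [MeasurableSingletonClass S]
    [Fintype A] [DecidableEq A] [Nonempty A] [MeasurableSpace A] [MeasurableSingletonClass A]
    [MeasurableSpace Ω] (P : Measure Ω) [IsProbabilityMeasure P]
    (M : TransientMDP S A)
    (B : Finset ℝ) (hB : ∀ β ∈ B, 0 < β) (β : ℝ) (hβ : β ∈ B) (zmin zmax : ℝ)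
    (η : ℕ → Ω → ℝ) (s : ℕ → Ω → S) (a : ℕ → Ω → A) (s' : ℕ → Ω → S)
    (hη_meas : ∀ i, Measurable (η i)) (hs_meas : ∀ i, Measurable (s i))
    (ha_meas : ∀ i, Measurable (a i)) (hs'_meas : ∀ i, Measurable (s' i))
    (hη_nonneg : ∀ᵐ ω ∂P, ∀ i, 0 ≤ η i ω)
    (hsamples : SamplesFollow M P η s a s')
    (hsteps : ∀ᵐ ω ∂P, ∀ x b, x ≠ M.e →
      RobbinsMonroAt (fun i => η i ω) (fun i => s i ω) (fun i => a i ω) x b)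
    (hz : ∀ᵐ ω ∂P, ∀ i q,
      ermQLearning M β zmin zmax (fun i => η i ω) (fun i => s i ω) (fun i => a i ω)
          (fun i => s' i ω) i = QState.running q →
        tdResidual M q (s i ω) (a i ω) (s' i ω) ∈ Set.Icc zmin zmax) :
    ∃ qinf : S → A → ℝ, qinf = ermBellman M β qinf ∧
      ∀ᵐ ω ∂P, ∀ x b,
        Tendsto
          (fun i => (ermQLearning M β zmin zmax (fun i => η i ω) (fun i => s i ω)
            (fun i => a i ω) (fun i => s' i ω) i).table x b)
          atTop (𝓝 ((qinf x b : ℝ) : EReal)) := by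
  have hβ0 : 0 < β := hB β hβ
  set F := sampleFiltration hη_meas hs_meas ha_meas hs'_meas
  set v : S → A → ℕ → Ω → ℝ := fun x b i ω =>
    visitStep (fun i => η i ω) (fun i => s i ω) (fun i => a i ω) x b i
  set q : ℕ → Ω → S → A → ℝ := fun i ω =>
    freeIterates M β (fun i => η i ω) (fun i => s i ω) (fun i => a i ω) (fun i => s' i ω) i
  have hqm : ∀ i x b, Measurable[F i] fun ω => q i ω x b := fun i x b =>
    measurable_freeIterates M β i x b
  have hpm : ∀ i y, Measurable[F i] fun ω => M.p (s i ω) (a i ω) y := fun i y =>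
    measurable_eval_of_finite (measurable_state_sampleHistory i) fun x =>
      measurable_eval_of_finite (measurable_action_sampleHistory i) fun b =>
        measurable_const (a := M.p x b y)
  have htdm : ∀ i y, Measurable[F i] fun ω => tdResidual M (q i ω) (s i ω) (a i ω) y :=
    fun i y => measurable_eval_of_finite (measurable_state_sampleHistory i) fun x =>
      measurable_eval_of_finite (measurable_action_sampleHistory i) fun b =>
        measurable_tdResidual M (hqm i) x b y
  set J : S → ℕ → Ω → ℝ := fun y i => (s' i ⁻¹' {y}).indicator fun _ => (1 : ℝ) with hJ
  have hJm : ∀ y i, Measurable[F (i + 1)] (J y i) := fun y i =>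
    measurable_const.indicator (measurable_next_sampleHistory i (measurableSet_singleton y))
  have hJ0 : ∀ y i ω, 0 ≤ J y i ω := fun y i ω =>
    Set.indicator_nonneg (fun _ _ => zero_le_one) ω
  have hJ1 : ∀ y i ω, J y i ω ≤ 1 := fun y i ω =>
    Set.indicator_le_self' (fun _ _ => zero_le_one) ω
  have hp1 : ∀ x b y, M.p x b y ≤ 1 := fun x b y => by
    rw [← M.p_sum x b]
    exact Finset.single_le_sum (fun y _ => M.p_nonneg x b y) (Finset.mem_univ y)
  have hJint : ∀ y i, Integrable (J y i) P := fun y i =>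
    integrable_of_abs_le ((hJm y i).mono (F.le _) le_rfl) fun ω => by
      rw [abs_of_nonneg (hJ0 y i ω)]; exact hJ1 y i ω
  have hpint : ∀ y i, Integrable (fun ω => M.p (s i ω) (a i ω) y) P := fun y i =>
    integrable_of_abs_le ((hpm i y).mono (F.le _) le_rfl) fun ω => by
      rw [abs_of_nonneg (M.p_nonneg _ _ _)]; exact hp1 _ _ _
  have hzero : ∀ y i {E : Set Ω}, MeasurableSet[F i] E → ((∀ᵐ ω ∂P, ω ∈ E → J y i ω = 0) ↔
      ∀ᵐ ω ∂P, ω ∈ E → M.p (s i ω) (a i ω) y = 0) := fun y i E hE =>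
    ae_eq_zero_iff_of_condExp (F.le i) (hJint y i) (hJ0 y i) (fun _ => M.p_nonneg _ _ _)
      (hsamples i y) hE
  have hJeq : ∀ y i ω, J y i ω = if s' i ω = y then 1 else 0 := fun y i ω => by
    by_cases h : s' i ω = y <;> simp [hJ, h]
  have hpos : ∀ᵐ ω ∂P, ∀ i, 0 < M.p (s i ω) (a i ω) (s' i ω) := by
    have h : ∀ i y, ∀ᵐ ω ∂P, M.p (s i ω) (a i ω) y = 0 → J y i ω = 0 := fun i y =>
      (hzero y i (hpm i y (measurableSet_singleton 0))).2 (ae_of_all _ fun ω hω => hω)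
    filter_upwards [ae_all_iff.2 fun i => ae_all_iff.2 fun y => h i y] with ω hω i
    refine lt_of_le_of_ne (M.p_nonneg _ _ _) fun h0 => ?_
    have := hω i (s' i ω) h0.symm
    simp [hJeq] at this
  have hrun : ∀ᵐ ω ∂P, ∀ i, ermQLearning M β zmin zmax (fun i => η i ω) (fun i => s i ω)
      (fun i => a i ω) (fun i => s' i ω) i = QState.running (q i ω) := by
    filter_upwards [hz] with ω hω i
    exact ermQLearning_eq_freeIterates M β zmin zmax hω i
  -- On the event that the residual for `y` is out of bounds, `y` is almost surely not sampled; the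
  -- event belongs to the history, so `y` has probability 0 there.
  have hsucc : ∀ᵐ ω ∂P, ∀ i y, 0 < M.p (s i ω) (a i ω) y →
      tdResidual M (q i ω) (s i ω) (a i ω) y ∈ Set.Icc zmin zmax := by
    have h : ∀ i y, ∀ᵐ ω ∂P, tdResidual M (q i ω) (s i ω) (a i ω) y ∈ (Set.Icc zmin zmax)ᶜ →
        M.p (s i ω) (a i ω) y = 0 := fun i y => by
      refine (hzero y i (htdm i y measurableSet_Icc.compl)).1 ?_
      filter_upwards [hz, hrun] with ω h1 h2 h3
      rw [hJeq, if_neg]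
      rintro rfl
      exact h3 (h1 i _ (h2 i))
    filter_upwards [ae_all_iff.2 fun i => ae_all_iff.2 fun y => h i y] with ω hω i y hy
    by_contra hn
    exact hy.ne' (hω i y hn)
  have hbdd : ∀ᵐ ω ∂P, ∃ K, ∀ i x b, |q i ω x b| ≤ K := by
    filter_upwards [hη_nonneg, hsteps, hpos, hsucc] with ω h1 h2 h3 h4
    exact exists_abs_freeIterates_le M hβ0 h1 h2 h3 h4
  -- The noise splits over the finitely many successors `y`: a coefficient known from the history
  -- times the centred variable `p - J`, bounded by 1.
  set H : S → A → S → ℕ → Ω → ℝ := fun x b y i ω =>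
    v x b i ω * Real.exp (-β * tdResidual M (q i ω) x b y) with hH
  set ξ : S → ℕ → Ω → ℝ := fun y i ω => M.p (s i ω) (a i ω) y - J y i ω with hξ
  have hnoise : ∀ x b, x ≠ M.e → ∀ y, ∀ᵐ ω ∂P,
      ∃ l, Tendsto (fun k => ∑ i ∈ Finset.range k, H x b y i ω * ξ y i ω) atTop (𝓝 l) := by
    intro x b hx y
    refine ae_tendsto_sum_mul_of_summable_sq (ℱ := F) (fun i => ?_) (fun i => ?_) (fun i ω => ?_)
      (fun i => ?_) ?_
    · exact Measurable.mul (measurable_visitStep x b i)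
        ((measurable_tdResidual M (hqm i) x b y).const_mul (-β)).exp
    · exact ((hpm i y).mono (F.mono (Nat.le_succ i)) le_rfl).sub (hJm y i)
    · have h1 := M.p_nonneg (s i ω) (a i ω) y
      have h2 := hp1 (s i ω) (a i ω) y
      have h3 := hJ0 y i ω
      have h4 := hJ1 y i ω
      rw [abs_le]
      constructor <;> simp only [hξ] <;> linarith
    · have h1 := condExp_sub (hpint y i) (hJint y i) (F i)
      have h2 := condExp_of_stronglyMeasurable (F.le i) (hpm i y).stronglyMeasurable (hpint y i)
      refine h1.trans ?_
      rw [h2]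
      filter_upwards [hsamples i y] with ω hω
      exact sub_eq_zero.2 hω.symm
    · filter_upwards [hbdd, hsteps] with ω ⟨K, hK⟩ h2
      refine Summable.of_nonneg_of_le (fun i => sq_nonneg _) (fun i => ?_)
        -- `|q| ≤ K` bounds the residual below by `r - 2 * K`. The constant `K` may depend on the
        -- path, since only pathwise summability is required.
        ((h2 x b hx).summable_sq.mul_right (Real.exp (-β * (M.r x b y - 2 * K)) ^ 2))
      rw [hH, mul_pow]
      refine mul_le_mul_of_nonneg_left (pow_le_pow_left₀ (Real.exp_pos _).le
        (Real.exp_le_exp.2 ?_) 2) (sq_nonneg _)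
      have h3 := (abs_le.1 (hK i y (Classical.arbitrary A))).1
      have h4 := le_maxQ (q i ω) y (Classical.arbitrary A)
      have h5 := (abs_le.1 (hK i x b)).2
      have h6 : M.r x b y - 2 * K ≤ tdResidual M (q i ω) x b y := by
        rw [tdResidual]; linarith
      nlinarith
  have hconv : ∀ᵐ ω ∂P, ∃ Q : S → A → ℝ, (∀ b, Q M.e b = 0) ∧ Q = ermBellman M β Q ∧
      ∀ x b, Tendsto (fun i => q i ω x b) atTop (𝓝 (Q x b)) := by
    have hnoise' : ∀ᵐ ω ∂P, ∀ x b y, x ≠ M.e →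
        ∃ l, Tendsto (fun k => ∑ i ∈ Finset.range k, H x b y i ω * ξ y i ω) atTop (𝓝 l) := by
      refine ae_all_iff.2 fun x => ae_all_iff.2 fun b => ae_all_iff.2 fun y => ?_
      by_cases hx : x = M.e
      · exact ae_of_all _ fun ω h => absurd hx h
      · filter_upwards [hnoise x b hx y] with ω hω _ using hω
    filter_upwards [hη_nonneg, hsteps, hpos, hbdd, hnoise'] with ω h1 h2 h3 h4 h5
    refine exists_tendsto_of_noise M hβ0 h1 h2 (q := fun i => q i ω)
      (n := fun x b i => ∑ y, H x b y i ω * ξ y i ω) (freeIterates_sink M h3) (fun i x b => ?_)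
      (fun x b hx => ?_) h4
    · have hT : Real.exp (β * q i ω x b) * expBackup M β (q i ω) x b =
          ∑ y, M.p x b y * Real.exp (-β * tdResidual M (q i ω) x b y) := exp_mul_expBackup ..
      have hJs : Real.exp (-β * tdResidual M (q i ω) x b (s' i ω)) =
          ∑ y, J y i ω * Real.exp (-β * tdResidual M (q i ω) x b y) := by
        simp [hJeq]
      have hsum : ∑ y, H x b y i ω * ξ y i ω = v x b i ω *
          (Real.exp (β * q i ω x b) * expBackup M β (q i ω) x b -
            Real.exp (-β * tdResidual M (q i ω) x b (s' i ω))) := by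
        rw [hT, hJs, ← Finset.sum_sub_distrib, Finset.mul_sum]
        refine Finset.sum_congr rfl fun y _ => ?_
        by_cases hvis : s i ω = x ∧ a i ω = b
        · simp only [hH, hξ, hvis.1, hvis.2]; ring
        · have : v x b i ω = 0 := if_neg hvis
          simp [hH, this]
      have hrec : q (i + 1) ω x b = q i ω x b - v x b i ω *
          (Real.exp (-β * tdResidual M (q i ω) x b (s' i ω)) - 1) := freeIterates_succ ..
      change q (i + 1) ω x b = q i ω x b - v x b i ω * _ + _
      rw [hrec, hsum]
      ring
    · choose l hl using fun y => h5 x b y hx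
      refine ⟨∑ y, l y, ?_⟩
      simp_rw [Finset.sum_comm (s := Finset.range _)]
      exact tendsto_finsetSum _ fun y _ => hl y
  -- One convergent path supplies the fixed point; no separate existence argument is needed.
  obtain ⟨-, Q, hQe, hQ, -⟩ := hconv.exists
  refine ⟨Q, hQ, ?_⟩
  filter_upwards [hconv, hrun] with ω ⟨Q', hQe', hQ', hlim⟩ h2 x b
  rw [fixedPoint_unique M hβ0 hQe hQe' hQ hQ']
  simp only [h2, QState.table]
  exact (continuous_coe_real_ereal.tendsto _).comp (hlim x b)
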